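/- Let ${\mathbb C}\{X_2\}$ be the free (nonunital) nonassociative algebra on $X_2=\{x_1,x_2\}$, that is, the complex vector space whose basis is the free magma generated by $x_1,x_2$, graded by the length of the monomials. Let $\mathrm{GL}_2({\mathbb C})$ act on it by $g(f(x_1,x_2))=f(g(x_1),g(x_2))$, where $g(x_j)=\sum_i g_{ij}x_i$. For a subgroup $G$ of $\mathrm{GL}_2({\mathbb C})$ let ${\mathbb C}\{X_2\}^G$ be the algebra of invariants $\{f\mid g(f)=f\text{ for all }g\in G\}$ and let \[ H({\mathbb C}\{X_2\}^G,t)=\sum_{n\ge 0}\dim\bigl(({\mathbb C}\{X_2\}^G)_n\bigr)\,t^n \] be its Hilbert series, where $({\mathbb C}\{X_2\}^G)_n$ consists of the invariants which are homogeneous of degree $n$. Let $\mathrm{UT}_2({\mathbb C})$ be the group of the matrices $\begin{pmatrix}1&\alpha\\0&1\end{pmatrix}$, $\alpha\in{\mathbb C}$. Then for all real $t$ with $|t|<1/8$ the two Hilbert series below converge and \[ H({\mathbb C}\{X_2\}^{\mathrm{SL}_2},t)=\int_0^1\sin^2(2\pi u)\left(1-\sqrt{1-8t\cos(2\pi u)}\right)du,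 \] \[ H({\mathbb C}\{X_2\}^{\mathrm{UT}_2},t)=\int_0^1\cos^2(\pi u)\left(1-\sqrt{1-8t\cos(2\pi u)}\right)du. \] Moreover, on $0<|t|<1/8$ both Hilbert series are elliptic integrals: each of them can be written as $\int_a^b R\bigl(t,x,\sqrt{P(t,x)}\bigr)\,dx$ with constants $a<b$, a polynomial $P(t,x)$ and a rational function $R(t,x,y)$ with real coefficients such that, for every such $t$, the polynomial $P(t,\cdot)$ has degree $3$ or $4$ and no multiple complex roots and is nonnegative on $[a,b]$, the denominator of $R$ does not vanish at $(t,x,\pm\sqrt{P(t,x)})$ for $x\in(a,b)$, the integral converges absolutely, and $R(t,x,\sqrt{P(t,x)})\ne R(t,x,-\sqrt{P(t,x)})$ for some $x\in(a,b)$. -/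

import Mathlib

noncomputable section

namespace FreeNonassocInvariants

/-- The free nonassociative algebra `ℂ{X_d}` on `d` generators: the complex vector space whose basis
is the free magma on `X_d`. It has no unit. -/
abbrev FreeAlg (d : ℕ) : Type := FreeNonUnitalNonAssocAlgebra ℂ (Fin d)

/-- The generator `x_j`. -/
def gen {d : ℕ} (j : Fin d) : FreeAlg d := FreeNonUnitalNonAssocAlgebra.of ℂ j

/-- The diagonal action of a matrix `g`: the algebra endomorphism determined by
`g(x_j) = ∑ i, g_ij x_i`, that is, `f(x_1, …, x_d) ↦ f(g(x_1), …, g(x_d))`. -/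
def act {d : ℕ} (g : GL (Fin d) ℂ) : FreeAlg d →ₙₐ[ℂ] FreeAlg d :=
  FreeNonUnitalNonAssocAlgebra.lift ℂ fun j => ∑ i, (g : Matrix (Fin d) (Fin d) ℂ) i j • gen i

/-- The algebra of invariants `ℂ{X_d}^G` of a subgroup `G` of `GL_d(ℂ)`. -/
def invariants {d : ℕ} (G : Subgroup (GL (Fin d) ℂ)) : NonUnitalSubalgebra ℂ (FreeAlg d) where
  carrier := {f | ∀ g ∈ G, act g f = f}
  add_mem' := fun ha hb g hg => by rw [map_add, ha g hg, hb g hg]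
  zero_mem' := fun g _ => map_zero (act g)
  mul_mem' := fun ha hb g hg => by rw [map_mul, ha g hg, hb g hg]
  smul_mem' := fun c _ hf g hg => by rw [map_smul, hf g hg]

/-- The homogeneous component of degree `n` of `ℂ{X_d}`, spanned by the nonassociative monomials
of length `n`. -/
def component (d n : ℕ) : Submodule ℂ (FreeAlg d) :=
  Submodule.span ℂ (MonoidAlgebra.ofMagma ℂ (FreeMagma (Fin d)) '' {w | w.length = n})

/-- The Hilbert series `∑ dim (A_n) t ^ n` of a graded subalgebra `A` of `ℂ{X_d}`,
where `A_n` consists of the elements of `A` which are homogeneous of degree `n`. -/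
def hilbertSeries {d : ℕ} (A : NonUnitalSubalgebra ℂ (FreeAlg d)) : PowerSeries ℕ :=
  PowerSeries.mk fun n => Module.finrank ℂ ↥(A.toSubmodule ⊓ component d n)

/-- `SL_2(ℂ)` as a subgroup of `GL_2(ℂ)`. -/
def SL2 : Subgroup (GL (Fin 2) ℂ) := (Matrix.GeneralLinearGroup.det : GL (Fin 2) ℂ →* ℂˣ).ker

/-- The unitriangular group `UT_2(ℂ)`, consisting of the matrices `(1, α; 0, 1)`; they act by
`x_1 ↦ x_1`, `x_2 ↦ x_2 + α x_1`. -/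
def UT2 : Subgroup (GL (Fin 2) ℂ) :=
  (Matrix.GeneralLinearGroup.upperRightHom : AddChar ℂ (GL (Fin 2) ℂ)).toMonoidHom.range

/-- The terms `h_n t ^ n` of the power series `h` at the real point `t`. -/
def terms (h : PowerSeries ℕ) (t : ℝ) (n : ℕ) : ℝ := ((PowerSeries.coeff n h : ℕ) : ℝ) * t ^ n

/-- The value at `(t, x, y)` of the rational function `N / D` in three variables. -/
def ratEval (N D : MvPolynomial (Fin 3) ℝ) (t x y : ℝ) : ℝ :=
  MvPolynomial.eval ![t, x, y] N / MvPolynomial.eval ![t, x, y] D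

/-- The function `F` of a real parameter `t ∈ T` is a (complete) elliptic integral:
`F(t) = ∫_a^b R(t, x, √P(t, x)) dx`, where `P(t, x)` is a polynomial which for every `t ∈ T` has
degree `3` or `4` in `x` and no multiple complex roots, and is nonnegative for `x ∈ [a, b]`, and
where `R = N / D` is a rational function whose denominator does not vanish at `(t, x, ±√P(t, x))`
for `x ∈ (a, b)` and which genuinely depends on the square root. -/
def IsEllipticIntegralOn (T : Set ℝ) (F : ℝ → ℝ) : Prop :=
  ∃ (a b : ℝ) (P : Polynomial (Polynomial ℝ)) (N D : MvPolynomial (Fin 3) ℝ), a < b ∧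
    ∀ t ∈ T, ∃ p : Polynomial ℝ, p = P.map (Polynomial.evalRingHom t) ∧
      (p.natDegree = 3 ∨ p.natDegree = 4) ∧ p.Separable ∧
      (∀ x ∈ Set.Icc a b, 0 ≤ p.eval x) ∧
      (∀ x ∈ Set.Ioo a b, MvPolynomial.eval ![t, x, √(p.eval x)] D ≠ 0 ∧
        MvPolynomial.eval ![t, x, -√(p.eval x)] D ≠ 0) ∧
      (∃ x ∈ Set.Ioo a b, ratEval N D t x √(p.eval x) ≠ ratEval N D t x (-√(p.eval x))) ∧
      IntervalIntegrable (fun x => ratEval N D t x √(p.eval x)) MeasureTheory.volume a b ∧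
      F t = ∫ x in a..b, ratEval N D t x √(p.eval x)

end FreeNonassocInvariants

end

/-!
A monomial of length `n` in `ℂ{x_1, x_2}` is a binary tree with `n` leaves labelled by `x_1, x_2`,
so there are `C_{n-1} * (n choose j)` monomials of length `n` and of degree `j` in `x_2`, where
`C_m` are the Catalan numbers (`card_words_filter_deg₂_eq`).

Let `E`, `F`, `H` be the derivations `raise`, `lower`, `weight` by which `𝔰𝔩₂` acts. As `1 + α M`
with `M ^ 2 = 0` acts as the exponential of the derivation `α M`, invariance under a unipotent
one-parameter group means being killed by its derivation (`act_eq_self_iff`). Hence the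
`UT_2`-invariants are `ker E`, and, as `SL_2` is generated by its unitriangular matrices, the
`SL_2`-invariants are `ker E ⊓ ker F`. The operators `E` and `F` are adjoint for the Hermitian form
with orthonormal monomials, so `[E, F] = H` gives `‖F f‖² = ‖E f‖² + ⟨f, H f⟩` (`normSq_lower`).
It follows that `E` is injective on negative weights, that `E ∘ F` is injective, so `E` surjective,
onto positive weights, and that `F` vanishes on the part of `ker E` of weight zero. Comparing
dimensions, the degree `n` parts of the invariants have the dimensions
`C_{n-1} * (n choose ⌊n / 2⌋)` for `UT_2`, and `C_{n-1} * C_{n/2}` with `n` even, or zero with `n`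
odd, for `SL_2` (`coeff_hilbertSeries_UT2`, `coeff_hilbertSeries_SL2`).

On the analytic side `1 - √(1 - 4 z) = 2 ∑ C_n z ^ (n + 1)` for `|z| ≤ 1 / 4` (`hasSum_catalan`).
With `z = 2 t cos (2 π u)` it may be integrated termwise, and the moments of the cosine produce the
second factor of the dimensions.

Finally `x = cos (2 π u)` turns the integrals into integrals over `[-1, 1]` involving
`y = √((1 - x ^ 2) (1 - 8 t x))` only: the integrands are `1 / 4 - y / π` for `SL_2` and
`1 / 4 - y / (2 π (1 - x))` for `UT_2`, the constant `1 / 4` accounting for the summand `1` of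
`1 - √(1 - 8 t x)`.
-/

noncomputable section

namespace FreeNonassocInvariants

section

open MonoidAlgebra

/-! ### Coefficients of products and derivations -/

/-- The monomial `w`, as an element of the free algebra. -/
def mon (w : FreeMagma (Fin 2)) : FreeAlg 2 := single w 1

theorem coeff_mon (v w : FreeMagma (Fin 2)) : (mon v).coeff w = if v = w then 1 else 0 := by
  simp [mon, Finsupp.single_apply]

theorem mon_mul (v w : FreeMagma (Fin 2)) : mon (v * w) = mon v * mon w := by
  simp [mon, single_mul_single]

theorem induction_mon {p : FreeAlg 2 → Prop} (f : FreeAlg 2) (zero : p 0)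
    (add : ∀ f g, p f → p g → p (f + g)) (smul : ∀ (c : ℂ) w, p (c • mon w)) : p f := by
  obtain ⟨f⟩ := f
  induction f using Finsupp.induction_linear with
  | zero => exact zero
  | add f g hf hg => exact add _ _ hf hg
  | single w c => simpa [mon] using smul c w

theorem linearMap_ext_mon {V : Type*} [AddCommMonoid V] [Module ℂ V] {L L' : FreeAlg 2 →ₗ[ℂ] V}
    (h : ∀ w, L (mon w) = L' (mon w)) : L = L' := by
  refine LinearMap.ext fun f => ?_
  induction f using induction_mon with
  | zero => simp
  | add f g hf hg => simp [hf, hg]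
  | smul c w => simp [h w]

/-- Since a product in the free magma determines its factors, the coefficients of a product of
elements of the free algebra are products of coefficients. -/
theorem coeff_mul_mul (f g : FreeAlg 2) (v w : FreeMagma (Fin 2)) :
    (f * g).coeff (v * w) = f.coeff v * g.coeff w := by
  induction f using induction_mon with
  | zero => simp
  | add f f' hf hf' => simp [add_mul, hf, hf']
  | smul c a =>
    induction g using induction_mon with
    | zero => simp
    | add g g' hg hg' => rw [mul_add, coeff_add, Finsupp.add_apply, hg, hg']; simp [mul_add]
    | smul d b =>
      have h : a * b = v * w ↔ a = v ∧ b = w := by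
        constructor
        · intro h; cases h; exact ⟨rfl, rfl⟩
        · rintro ⟨rfl, rfl⟩; rfl
      simp only [smul_mul_smul_comm, ← mon_mul, coeff_smul, Finsupp.smul_apply, coeff_mon, h]
      by_cases h1 : a = v <;> by_cases h2 : b = w <;> simp [h1, h2]

theorem coeff_mul_of (f g : FreeAlg 2) (i : Fin 2) : (f * g).coeff (FreeMagma.of i) = 0 := by
  induction f using induction_mon with
  | zero => simp
  | add f f' hf hf' => simp [add_mul, hf, hf']
  | smul c a =>
    induction g using induction_mon with
    | zero => simp
    | add g g' hg hg' => rw [mul_add, coeff_add, Finsupp.add_apply, hg, hg']; simp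
    | smul d b =>
      have h : a * b ≠ FreeMagma.of i := fun h => by cases h
      simp [smul_mul_smul_comm, ← mon_mul, coeff_mon, h]

/-- The value at a monomial of the derivation with `x_j ↦ ∑ i, M_ij x_i`. -/
def derMon (M : Matrix (Fin 2) (Fin 2) ℂ) : FreeMagma (Fin 2) → FreeAlg 2
  | .of j => ∑ i, M i j • gen i
  | .mul v w => derMon M v * mon w + mon v * derMon M w

/-- The derivation of the free algebra with `x_j ↦ ∑ i, M_ij x_i`: the action of the element `M`
of the Lie algebra `𝔤𝔩₂`. -/
def der (M : Matrix (Fin 2) (Fin 2) ℂ) : FreeAlg 2 →ₗ[ℂ] FreeAlg 2 :=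
  Finsupp.linearCombination ℂ (derMon M) ∘ₗ (coeffLinearEquiv ℂ).toLinearMap

variable (M N : Matrix (Fin 2) (Fin 2) ℂ)

theorem der_mon (w : FreeMagma (Fin 2)) : der M (mon w) = derMon M w := by
  simp [der, mon]

theorem der_mon_of (j : Fin 2) : der M (mon (.of j)) = ∑ i, M i j • mon (.of i) := der_mon M _

theorem der_mul (f g : FreeAlg 2) : der M (f * g) = der M f * g + f * der M g := by
  induction f using induction_mon with
  | zero => simp
  | add f f' hf hf' => simp only [add_mul, map_add, hf, hf']; abel
  | smul c a =>
    induction g using induction_mon with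
    | zero => simp
    | add g g' hg hg' => simp only [mul_add, map_add, hg, hg']; abel
    | smul d b =>
      have : derMon M (a * b) = derMon M a * mon b + mon a * derMon M b := rfl
      simp only [smul_mul_smul_comm, map_smul, ← mon_mul, der_mon, this, smul_add]

theorem der_comm (f : FreeAlg 2) :
    der M (der N f) - der N (der M f) = der (M * N - N * M) f := by
  suffices h : der M ∘ₗ der N - der N ∘ₗ der M = der (M * N - N * M) from
    congr($h f)
  refine linearMap_ext_mon fun w => ?_
  induction w with
  | ih1 j =>
    simp only [LinearMap.sub_apply, LinearMap.comp_apply, der_mon_of, map_add, map_smul,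
      Fin.sum_univ_two, Matrix.sub_apply, Matrix.mul_apply]
    module
  | ih2 v w hv hw =>
    simp only [mon_mul, LinearMap.sub_apply, LinearMap.comp_apply, der_mul, map_add] at hv hw ⊢
    rw [← hv, ← hw]
    simp only [sub_mul, mul_sub]
    abel

/-- If `δ` is a grading of the free magma for which the linear map `M` is homogeneous of degree `a`
on the span of the generators, then the derivation `der M` is homogeneous of degree `a`. -/
theorem degree_of_coeff_der_ne_zero {A : Type*} [AddCommGroup A] (δ : FreeMagma (Fin 2) → A)
    (hδ : ∀ v w, δ (v * w) = δ v + δ w) (a : A)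
    (hM : ∀ i j, M i j ≠ 0 → δ (.of i) = δ (.of j) + a) (f : FreeAlg 2) (v : FreeMagma (Fin 2))
    (hv : (der M f).coeff v ≠ 0) : ∃ w, f.coeff w ≠ 0 ∧ δ v = δ w + a := by
  have key : ∀ w v, (der M (mon w)).coeff v ≠ 0 → δ v = δ w + a := by
    intro w
    induction w with
    | ih1 j =>
      intro v hv
      rw [der_mon_of] at hv
      by_contra hne
      refine hv ?_
      simp only [coeff_sum, Finsupp.finsetSum_apply, coeff_smul, Finsupp.smul_apply, coeff_mon]
      refine Finset.sum_eq_zero fun i _ => ?_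
      by_cases hi : FreeMagma.of i = v
      · subst hi
        have : M i j = 0 := by
          by_contra h
          exact hne (hM i j h)
        simp [this]
      · simp [hi]
    | ih2 x y hx hy =>
      intro v hv
      rw [mon_mul, der_mul] at hv
      induction v with
      | ih1 i => simp [coeff_mul_of] at hv
      | ih2 v v' =>
        simp only [coeff_add, Finsupp.add_apply, coeff_mul_mul, coeff_mon] at hv
        rw [hδ, hδ]
        by_cases h1 : (der M (mon x)).coeff v * (if y = v' then 1 else 0) = 0
        · rw [h1, zero_add] at hv
          have h2 := right_ne_zero_of_mul hv
          have h3 := left_ne_zero_of_mul hv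
          rw [hy v' h2, ← show x = v by by_contra h; simp [h] at h3]
          abel
        · have h2 := left_ne_zero_of_mul h1
          have h3 := right_ne_zero_of_mul h1
          rw [hx v h2, ← show y = v' by by_contra h; simp [h] at h3]
          abel
  have hf : der M f = f.coeff.sum fun w c => c • der M (mon w) := by
    simp only [der_mon]; rfl
  rw [hf, coeff_finsuppSum, Finsupp.sum_apply] at hv
  obtain ⟨w, hw, h⟩ := Finset.exists_ne_zero_of_sum_ne_zero hv
  refine ⟨w, Finsupp.mem_support_iff.1 hw, key w v ?_⟩
  intro h0
  simp [h0] at h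

/-! ### The Hermitian form for which monomials are orthonormal -/

/-- The Hermitian form on the free algebra for which the monomials are orthonormal; it is
conjugate-linear in the first variable. -/
def herm (f g : FreeAlg 2) : ℂ := f.coeff.sum fun w c => (starRingEnd ℂ) c * g.coeff w

theorem herm_add_left (f f' g : FreeAlg 2) : herm (f + f') g = herm f g + herm f' g := by
  unfold herm
  rw [coeff_add, Finsupp.sum_add_index'] <;> simp [add_mul]

theorem herm_smul_left (c : ℂ) (f g : FreeAlg 2) :
    herm (c • f) g = (starRingEnd ℂ) c * herm f g := by
  unfold herm
  rw [coeff_smul, Finsupp.sum_smul_index (by simp), Finsupp.mul_sum]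
  simp [mul_assoc]

theorem herm_add_right (f g g' : FreeAlg 2) : herm f (g + g') = herm f g + herm f g' := by
  simp [herm, mul_add, Finsupp.sum_add]

theorem herm_smul_right (c : ℂ) (f g : FreeAlg 2) : herm f (c • g) = c * herm f g := by
  simp [herm, Finsupp.mul_sum, mul_left_comm]

theorem herm_zero_left (g : FreeAlg 2) : herm 0 g = 0 := by simp [herm]

theorem herm_zero_right (f : FreeAlg 2) : herm f 0 = 0 := by simp [herm]

theorem herm_mon_left (w : FreeMagma (Fin 2)) (g : FreeAlg 2) : herm (mon w) g = g.coeff w := by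
  simp [herm, mon]

theorem conj_herm (f g : FreeAlg 2) : (starRingEnd ℂ) (herm f g) = herm g f := by
  induction f using induction_mon with
  | zero => simp [herm_zero_left, herm_zero_right]
  | add f f' hf hf' => simp [herm_add_left, herm_add_right, hf, hf']
  | smul c v =>
    simp only [herm_smul_left, herm_smul_right, map_mul, Complex.conj_conj]
    congr 1
    induction g using induction_mon with
    | zero => simp [herm_zero_left, herm_zero_right]
    | add f f' hf hf' => simp [herm_add_left, herm_add_right, hf, hf']
    | smul c w =>
      rcases eq_or_ne v w with rfl | h
      · simp [herm_smul_left, herm_smul_right, herm_mon_left, coeff_mon]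
      · simp [herm_smul_left, herm_smul_right, herm_mon_left, coeff_mon, h, h.symm]

/-- The squared norm of an element of the free algebra, for the form `herm`. -/
def normSq (f : FreeAlg 2) : ℝ := f.coeff.sum fun _ c => ‖c‖ ^ 2

theorem herm_self (f : FreeAlg 2) : herm f f = normSq f := by
  simp only [herm, normSq, Finsupp.sum, Complex.ofReal_sum]
  exact Finset.sum_congr rfl fun w _ => by rw [Complex.conj_mul', Complex.ofReal_pow]

theorem normSq_nonneg (f : FreeAlg 2) : 0 ≤ normSq f :=
  Finset.sum_nonneg fun _ _ => by positivity

theorem eq_zero_of_normSq_eq_zero {f : FreeAlg 2} (h : normSq f = 0) : f = 0 := by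
  unfold normSq Finsupp.sum at h
  rw [Finset.sum_eq_zero_iff_of_nonneg fun _ _ => by positivity] at h
  ext w
  by_contra hw
  exact hw (by simpa using h w (Finsupp.mem_support_iff.2 hw))

/-- The monomials being orthonormal, the derivations of adjoint matrices are adjoint. -/
theorem herm_der (f g : FreeAlg 2) : herm (der M f) g = herm f (der M.conjTranspose g) := by
  induction f using induction_mon with
  | zero => simp [herm_zero_left]
  | add f f' hf hf' => simp [herm_add_left, hf, hf']
  | smul c v =>
    rw [map_smul, herm_smul_left, herm_smul_left]
    congr 1
    induction g using induction_mon with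
    | zero => simp [herm_zero_right]
    | add f f' hf hf' => simp [herm_add_right, hf, hf']
    | smul c w =>
      rw [map_smul, herm_smul_right, herm_smul_right, herm_mon_left, ← conj_herm, herm_mon_left]
      congr 1
      induction v generalizing w with
      | ih1 j =>
        induction w with
        | ih1 i =>
          have h (i j : Fin 2) : FreeMagma.of i = .of j ↔ i = j :=
            ⟨fun h => by cases h; rfl, congrArg _⟩
          simp only [der_mon_of, coeff_add, coeff_smul, Finsupp.add_apply, Finsupp.smul_apply,
            Fin.sum_univ_two, coeff_mon, h]
          fin_cases i <;> fin_cases j <;> simp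
        | ih2 w w' =>
          have h (i : Fin 2) : FreeMagma.of i ≠ w * w' := fun h => by cases h
          simp [mon_mul, der_mul, coeff_mul_of, der_mon_of, coeff_mon, h]
      | ih2 v v' hv hv' =>
        induction w with
        | ih1 i =>
          have h (i : Fin 2) : FreeMagma.of i ≠ v * v' := fun h => by cases h
          simp [mon_mul, der_mul, coeff_mul_of, der_mon_of, coeff_mon, h]
        | ih2 w w' =>
          simp only [mon_mul, der_mul, coeff_add, Finsupp.add_apply, coeff_mul_mul, map_add,
            map_mul, hv, hv', coeff_mon, eq_comm]
          congr 2
          all_goals split_ifs <;> simp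

/-! ### Invariants of one-parameter unipotent groups -/

theorem act_gen (g : GL (Fin 2) ℂ) (j : Fin 2) : act g (gen j) = ∑ i, g.1 i j • gen i :=
  FreeNonUnitalNonAssocAlgebra.lift_of_apply ..

theorem act_mon_of (g : GL (Fin 2) ℂ) (j : Fin 2) :
    act g (mon (.of j)) = ∑ i, g.1 i j • mon (.of i) := act_gen g j

theorem act_mul (g h : GL (Fin 2) ℂ) (f : FreeAlg 2) : act (g * h) f = act g (act h f) := by
  suffices H : act (g * h) = (act g).comp (act h) from congr($H f)
  refine FreeNonUnitalNonAssocAlgebra.hom_ext ℂ fun j => ?_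
  change act (g * h) (gen j) = act g (act h (gen j))
  simp only [act_gen, Fin.sum_univ_two, Units.val_mul, Matrix.mul_apply]
  simp only [map_add, map_smul, act_gen, Fin.sum_univ_two]
  module

theorem act_one (f : FreeAlg 2) : act 1 f = f := by
  suffices H : act (1 : GL (Fin 2) ℂ) = NonUnitalAlgHom.id ℂ (FreeAlg 2) from congr($H f)
  refine FreeNonUnitalNonAssocAlgebra.hom_ext ℂ fun j => ?_
  change act 1 (gen j) = gen j
  simp [act_gen, Matrix.one_apply]

/-- Differentiating the action of the one-parameter group `1 + α M = exp (α M)`, where `M ^ 2 = 0`,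
gives the derivation `der M`. -/
theorem hasDerivAt_coeff_act {M : Matrix (Fin 2) (Fin 2) ℂ} (hM : M * M = 0)
    {g : ℂ → GL (Fin 2) ℂ} (hg : ∀ α, (g α).1 = 1 + α • M) (f : FreeAlg 2)
    (w : FreeMagma (Fin 2)) (α : ℂ) :
    HasDerivAt (fun α => (act (g α) f).coeff w) ((act (g α) (der M f)).coeff w) α := by
  induction f using induction_mon with
  | zero => simpa using hasDerivAt_const α (0 : ℂ)
  | add f f' hf hf' =>
    simp only [map_add, coeff_add, Finsupp.add_apply]
    exact hf.add hf'
  | smul c v =>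
    simp only [map_smul, coeff_smul, Finsupp.smul_apply]
    refine HasDerivAt.const_smul c ?_
    induction v generalizing w with
    | ih1 j =>
      have h1 (α : ℂ) : act (g α) (mon (.of j)) = mon (.of j) + α • ∑ i, M i j • mon (.of i) := by
        simp only [act_mon_of, hg, Matrix.add_apply, Matrix.smul_apply, add_smul,
          Finset.sum_add_distrib, Finset.smul_sum, smul_assoc]
        simp [Matrix.one_apply]
      have h2 : act (g α) (der M (mon (.of j))) = ∑ i, M i j • mon (.of i) := by
        have h3 : (g α).1 * M = M := by rw [hg, add_mul, smul_mul_assoc, hM]; simp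
        have h4 (k : Fin 2) : (g α).1 k 0 * M 0 j + (g α).1 k 1 * M 1 j = M k j := by
          rw [← Fin.sum_univ_two fun i => (g α).1 k i * M i j, ← Matrix.mul_apply, h3]
        simp only [der_mon_of, Fin.sum_univ_two, map_add, map_smul, act_mon_of]
        linear_combination (norm := module) (h4 0) • mon (.of 0) + (h4 1) • mon (.of 1)
      simp only [h1, h2, coeff_add, Finsupp.add_apply, coeff_smul, Finsupp.smul_apply, smul_eq_mul]
      simpa using ((hasDerivAt_id α).mul_const ((∑ i, M i j • mon (.of i)).coeff w)).const_add
        ((mon (.of j)).coeff w)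
    | ih2 v v' hv hv' =>
      simp only [mon_mul, der_mul, map_mul, map_add]
      induction w with
      | ih1 i => simpa [coeff_mul_of] using hasDerivAt_const α (0 : ℂ)
      | ih2 w w' =>
        simp only [coeff_add, Finsupp.add_apply, coeff_mul_mul]
        exact (hv w).mul (hv' w')

/-- An element is invariant under the group `1 + α M`, `M ^ 2 = 0`, if and only if it is a constant
of the derivation `der M`. -/
theorem act_eq_self_iff {M : Matrix (Fin 2) (Fin 2) ℂ} (hM : M * M = 0)
    {g : ℂ → GL (Fin 2) ℂ} (hg : ∀ α, (g α).1 = 1 + α • M) (f : FreeAlg 2) :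
    (∀ α, act (g α) f = f) ↔ der M f = 0 := by
  have h0 : g 0 = 1 := Units.ext (by simp [hg])
  constructor
  · intro h
    ext w
    have := hasDerivAt_coeff_act hM hg f w 0
    simp only [h, h0, act_one] at this
    exact this.unique (hasDerivAt_const _ _)
  · intro h α
    ext w
    have hd (α : ℂ) : HasDerivAt (fun α => (act (g α) f).coeff w) 0 α := by
      simpa [h] using hasDerivAt_coeff_act hM hg f w α
    have := is_const_of_deriv_eq_zero (fun α => (hd α).differentiableAt) (fun α => (hd α).deriv) α 0
    simpa [h0, act_one] using this

/-! ### The action of `𝔰𝔩₂` -/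

/-- The raising operator `x_1 ↦ 0`, `x_2 ↦ x_1`. -/
def raise : FreeAlg 2 →ₗ[ℂ] FreeAlg 2 := der !![0, 1; 0, 0]

/-- The lowering operator `x_1 ↦ x_2`, `x_2 ↦ 0`. -/
def lower : FreeAlg 2 →ₗ[ℂ] FreeAlg 2 := der !![0, 0; 1, 0]

/-- The weight operator `x_1 ↦ x_1`, `x_2 ↦ -x_2`. -/
def weight : FreeAlg 2 →ₗ[ℂ] FreeAlg 2 := der !![1, 0; 0, -1]

/-- The degree of a monomial in `x_2`. -/
def deg₂ : FreeMagma (Fin 2) → ℕ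
  | .of j => j
  | .mul v w => deg₂ v + deg₂ w

theorem deg₂_of (j : Fin 2) : deg₂ (.of j) = j := rfl

theorem deg₂_mul (v w : FreeMagma (Fin 2)) : deg₂ (v * w) = deg₂ v + deg₂ w := rfl

theorem length_of (j : Fin 2) : (FreeMagma.of j).length = 1 := rfl

theorem length_mul (v w : FreeMagma (Fin 2)) : (v * w).length = v.length + w.length := rfl

theorem raise_lower_sub (f : FreeAlg 2) : raise (lower f) - lower (raise f) = weight f := by
  unfold raise lower weight
  rw [der_comm]
  congr 2
  ext i j
  fin_cases i <;> fin_cases j <;> simp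

/-- Monomials are weight vectors: the weight is the degree in `x_1` minus the degree in `x_2`. -/
theorem coeff_weight (f : FreeAlg 2) (w : FreeMagma (Fin 2)) :
    (weight f).coeff w = (w.length - 2 * deg₂ w : ℂ) * f.coeff w := by
  suffices h : ∀ v, weight (mon v) = (v.length - 2 * deg₂ v : ℂ) • mon v by
    induction f using induction_mon with
    | zero => simp
    | add f f' hf hf' => simp [hf, hf', mul_add]
    | smul c v =>
      rcases eq_or_ne v w with rfl | hvw
      · simp [h, coeff_mon, mul_comm]
      · simp [h, coeff_mon, hvw]
  intro v
  unfold weight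
  induction v with
  | ih1 j => fin_cases j <;> simp [der_mon_of, deg₂_of]; norm_num
  | ih2 v w hv hw =>
    rw [mon_mul, der_mul, hv, hw, smul_mul_assoc, mul_smul_comm, ← add_smul, deg₂_mul, length_mul]
    congr 1
    push_cast
    ring

theorem herm_raise (f g : FreeAlg 2) : herm (raise f) g = herm f (lower g) := by
  unfold raise lower
  rw [herm_der]
  congr 3
  ext i j
  fin_cases i <;> fin_cases j <;> simp

theorem herm_lower (f g : FreeAlg 2) : herm (lower f) g = herm f (raise g) := by
  rw [← conj_herm, ← herm_raise, conj_herm]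

/-- The commutation relation of `𝔰𝔩₂` and the adjointness of the raising and the lowering operator
compare the norms of their values. -/
theorem normSq_lower (f : FreeAlg 2) :
    normSq (lower f) = normSq (raise f) +
      f.coeff.sum fun w c => ((w.length : ℝ) - 2 * deg₂ w) * ‖c‖ ^ 2 := by
  have h1 : herm (lower f) (lower f) = herm (raise f) (raise f) + herm f (weight f) := by
    rw [herm_lower, herm_raise, ← herm_add_right, ← raise_lower_sub]
    congr 1
    abel
  have h2 : herm f (weight f) =
      ((f.coeff.sum fun w c => ((w.length : ℝ) - 2 * deg₂ w) * ‖c‖ ^ 2 : ℝ) : ℂ) := by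
    simp only [herm, Finsupp.sum, Complex.ofReal_sum, coeff_weight]
    refine Finset.sum_congr rfl fun w _ => ?_
    push_cast
    rw [mul_left_comm, Complex.conj_mul']
  rw [h2, herm_self, herm_self] at h1
  exact_mod_cast h1

/-- The lowering operator vanishes on highest weight vectors without positive weights. -/
theorem lower_eq_zero_of_raise_eq_zero {f : FreeAlg 2} (hf : raise f = 0)
    (hw : ∀ w, f.coeff w ≠ 0 → w.length ≤ 2 * deg₂ w) : lower f = 0 := by
  refine eq_zero_of_normSq_eq_zero (le_antisymm ?_ (normSq_nonneg _))
  rw [normSq_lower, hf, show normSq 0 = 0 by simp [normSq], zero_add]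
  refine Finset.sum_nonpos fun w h => ?_
  have : (w.length : ℝ) ≤ 2 * deg₂ w := by exact_mod_cast hw w (Finsupp.mem_support_iff.1 h)
  exact mul_nonpos_of_nonpos_of_nonneg (by linarith) (by positivity)

/-- The raising operator is injective on negative weights. -/
theorem eq_zero_of_raise_eq_zero {f : FreeAlg 2} (hf : raise f = 0)
    (hw : ∀ w, f.coeff w ≠ 0 → w.length < 2 * deg₂ w) : f = 0 := by
  have h := normSq_lower f
  rw [lower_eq_zero_of_raise_eq_zero hf fun w h => (hw w h).le, hf,
    show normSq 0 = 0 by simp [normSq], zero_add] at h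
  by_contra hne
  obtain ⟨w, hwf⟩ : ∃ w, f.coeff w ≠ 0 := by
    by_contra! h
    exact hne (by ext w; simpa using h w)
  refine absurd h (ne_of_gt ?_)
  refine Finset.sum_neg (fun w h => ?_) ⟨w, Finsupp.mem_support_iff.2 hwf⟩
  have h' := Finsupp.mem_support_iff.1 h
  have : (w.length : ℝ) < 2 * deg₂ w := by exact_mod_cast hw w h'
  exact mul_neg_of_neg_of_pos (by linarith) (by positivity)

/-- The composite `raise ∘ lower` is injective on positive weights. -/
theorem eq_zero_of_raise_lower_eq_zero {f : FreeAlg 2} (hf : raise (lower f) = 0)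
    (hw : ∀ w, f.coeff w ≠ 0 → 2 * deg₂ w < w.length) : f = 0 := by
  have h0 : normSq (lower f) = 0 := by
    have := herm_lower f (lower f)
    rw [hf, herm_zero_right, herm_self] at this
    exact_mod_cast this
  have h := normSq_lower f
  rw [h0] at h
  by_contra hne
  obtain ⟨w, hwf⟩ : ∃ w, f.coeff w ≠ 0 := by
    by_contra! h
    exact hne (by ext w; simpa using h w)
  refine absurd h (ne_of_lt (add_pos_of_nonneg_of_pos (normSq_nonneg _) ?_))
  refine Finset.sum_pos (fun w h => ?_) ⟨w, Finsupp.mem_support_iff.2 hwf⟩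
  have h' := Finsupp.mem_support_iff.1 h
  have : (2 * deg₂ w : ℝ) < w.length := by exact_mod_cast hw w h'
  exact mul_pos (by linarith) (by positivity)

theorem exists_coeff_of_coeff_raise {f : FreeAlg 2} {v : FreeMagma (Fin 2)}
    (hv : (raise f).coeff v ≠ 0) :
    ∃ w, f.coeff w ≠ 0 ∧ v.length = w.length ∧ deg₂ v + 1 = deg₂ w := by
  obtain ⟨w, h1, h2⟩ := degree_of_coeff_der_ne_zero _
    (fun w => ((w.length : ℤ), (deg₂ w : ℤ))) (by simp [deg₂_mul]) (0, -1)
    (by intro i j; fin_cases i <;> fin_cases j <;> simp [deg₂_of]) f v hv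
  simp only [Prod.mk_add_mk, Prod.mk.injEq] at h2
  exact ⟨w, h1, by lia, by lia⟩

theorem exists_coeff_of_coeff_lower {f : FreeAlg 2} {v : FreeMagma (Fin 2)}
    (hv : (lower f).coeff v ≠ 0) :
    ∃ w, f.coeff w ≠ 0 ∧ v.length = w.length ∧ deg₂ v = deg₂ w + 1 := by
  obtain ⟨w, h1, h2⟩ := degree_of_coeff_der_ne_zero _
    (fun w => ((w.length : ℤ), (deg₂ w : ℤ))) (by simp [deg₂_mul]) (0, 1)
    (by intro i j; fin_cases i <;> fin_cases j <;> simp [deg₂_of]) f v hv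
  simp only [Prod.mk_add_mk, Prod.mk.injEq] at h2
  exact ⟨w, h1, by lia, by lia⟩

/-! ### Counting monomials -/

/-- Generators as elements of the free magma. -/
def ofEmb : Fin 2 ↪ FreeMagma (Fin 2) := ⟨FreeMagma.of, fun _ _ h => by cases h; rfl⟩

/-- The multiplication of the free magma is injective. -/
def mulEmb : FreeMagma (Fin 2) × FreeMagma (Fin 2) ↪ FreeMagma (Fin 2) :=
  ⟨fun p => p.1 * p.2, by rintro ⟨_, _⟩ ⟨_, _⟩ h; cases h; rfl⟩

theorem ofEmb_apply (j : Fin 2) : ofEmb j = .of j := rfl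

theorem mulEmb_apply (p : FreeMagma (Fin 2) × FreeMagma (Fin 2)) : mulEmb p = p.1 * p.2 := rfl

/-- The monomials of length `n`. -/
def words : ℕ → Finset (FreeMagma (Fin 2))
  | 0 => ∅
  | 1 => Finset.univ.map ofEmb
  | n + 2 => (Finset.HasAntidiagonal.antidiagonal n).attach.biUnion fun ij =>
      have := Finset.HasAntidiagonal.mem_antidiagonal.1 ij.2
      (words (ij.1.1 + 1) ×ˢ words (ij.1.2 + 1)).map mulEmb
  termination_by n => n
  decreasing_by all_goals lia

theorem words_zero : words 0 = ∅ := by rw [words]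

theorem words_one : words 1 = Finset.univ.map ofEmb := by rw [words]

theorem words_add_two (n : ℕ) : words (n + 2) =
    (Finset.HasAntidiagonal.antidiagonal n).biUnion fun ij =>
      (words (ij.1 + 1) ×ˢ words (ij.2 + 1)).map mulEmb := by
  rw [words]
  ext
  simp

theorem mem_words (n : ℕ) (w : FreeMagma (Fin 2)) : w ∈ words n ↔ w.length = n := by
  induction w generalizing n with
  | ih1 j =>
    rcases n with _ | _ | n
    · simp [words_zero]
    · simp only [zero_add, words_one, Finset.mem_map, Finset.mem_univ, true_and, ofEmb_apply]
      exact ⟨fun _ => rfl, fun _ => ⟨j, rfl⟩⟩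
    · simp only [words_add_two, Finset.mem_biUnion, Finset.mem_map, length_of]
      constructor
      · rintro ⟨_, _, _, _, h⟩
        cases h
      · lia
  | ih2 v w hv hw =>
    have h1 := v.length_pos
    have h2 := w.length_pos
    rw [length_mul]
    rcases n with _ | _ | n
    · simp only [words_zero, Finset.notMem_empty, false_iff]; lia
    · simp only [zero_add, words_one, Finset.mem_map]
      constructor
      · rintro ⟨_, _, h⟩
        cases h
      · lia
    · simp only [words_add_two, Finset.mem_biUnion, Finset.mem_map, Finset.mem_product,
        Prod.exists, mulEmb_apply]
      constructor
      · rintro ⟨i, j, hij, v', w', ⟨h3, h4⟩, h⟩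
        rw [Finset.HasAntidiagonal.mem_antidiagonal] at hij
        cases h
        rw [hv] at h3
        rw [hw] at h4
        lia
      · intro h
        refine ⟨v.length - 1, w.length - 1, Finset.HasAntidiagonal.mem_antidiagonal.2 (by lia),
          v, w, ⟨?_, ?_⟩, rfl⟩
        · rw [hv]; lia
        · rw [hw]; lia

open Polynomial in
/-- The polynomial counting the monomials of a given length by their degree in `x_2`. -/
theorem sum_words_X_pow_deg₂ (n : ℕ) :
    ∑ w ∈ words (n + 1), (X : ℕ[X]) ^ deg₂ w = C (catalan n) * (1 + X) ^ (n + 1) := by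
  induction n using Nat.strong_induction_on with
  | _ n ih =>
    rcases n with _ | n
    · simp only [zero_add, words_one, Finset.sum_map, ofEmb_apply, Fin.sum_univ_two, deg₂_of]
      simp
    · have hdisj : Set.PairwiseDisjoint (↑(Finset.HasAntidiagonal.antidiagonal n))
          fun ij : ℕ × ℕ => (words (ij.1 + 1) ×ˢ words (ij.2 + 1)).map mulEmb := by
        rintro ⟨i, j⟩ - ⟨i', j'⟩ - hne
        refine Finset.disjoint_left.2 fun w hw hw' => hne ?_
        simp only [Finset.mem_map, Finset.mem_product, mem_words, Prod.exists,
          mulEmb_apply] at hw hw'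
        obtain ⟨u, v, ⟨h1, h2⟩, h⟩ := hw
        obtain ⟨u', v', ⟨h1', h2'⟩, h'⟩ := hw'
        rw [← h'] at h
        cases h
        simp only [Prod.mk.injEq]
        lia
      rw [words_add_two, Finset.sum_biUnion hdisj, catalan_succ', map_sum, Finset.sum_mul]
      refine Finset.sum_congr rfl fun ij hij => ?_
      have hij := Finset.HasAntidiagonal.mem_antidiagonal.1 hij
      rw [Finset.sum_map, Finset.sum_product]
      simp only [mulEmb_apply, deg₂_mul, pow_add, ← Finset.mul_sum,
        ← Finset.sum_mul]
      rw [ih _ (by lia), ih _ (by lia), ← hij, C_mul]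
      ring

/-- There are `C_n` binary trees with `n + 1` leaves. -/
theorem card_words_filter_deg₂_eq (n j : ℕ) :
    ((words (n + 1)).filter fun w => deg₂ w = j).card = catalan n * (n + 1).choose j := by
  have h := congr(Polynomial.coeff $(sum_words_X_pow_deg₂ n) j)
  rw [Polynomial.coeff_C_mul, Polynomial.coeff_one_add_X_pow, Polynomial.finsetSum_coeff] at h
  simp only [Polynomial.coeff_X_pow, eq_comm (a := j), ← Finset.card_filter] at h
  exact_mod_cast h

/-! ### Highest weight vectors -/

/-- The span of the monomials of length `n` whose degree in `x_2` lies in `S`. -/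
def wordSpan (n : ℕ) (S : Set ℕ) : Submodule ℂ (FreeAlg 2) :=
  (Finsupp.supported ℂ ℂ {w | w.length = n ∧ deg₂ w ∈ S}).comap
    (coeffLinearEquiv ℂ).toLinearMap

theorem mem_wordSpan {n : ℕ} {S : Set ℕ} {f : FreeAlg 2} :
    f ∈ wordSpan n S ↔ ∀ w, f.coeff w ≠ 0 → w.length = n ∧ deg₂ w ∈ S := by
  simp only [wordSpan, Submodule.mem_comap, Finsupp.mem_supported]
  constructor
  · intro h w hw
    exact h (Finsupp.mem_support_iff.2 hw)
  · intro h w hw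
    exact h w (Finsupp.mem_support_iff.1 hw)

theorem component_eq_wordSpan (n : ℕ) : component 2 n = wordSpan n Set.univ := by
  unfold component wordSpan
  rw [Finsupp.supported_eq_span_single, Submodule.comap_equiv_eq_map_symm, Submodule.map_span,
    Set.image_image]
  congr 1
  ext f
  simp [MonoidAlgebra.ofMagma]

theorem coe_filter_words (n : ℕ) (S : Set ℕ) [DecidablePred (· ∈ S)] :
    (↑((words n).filter fun w => deg₂ w ∈ S) : Set (FreeMagma (Fin 2))) =
      {w | w.length = n ∧ deg₂ w ∈ S} := by
  ext w
  simp [mem_words]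

theorem finrank_wordSpan (n : ℕ) (S : Set ℕ) [DecidablePred (· ∈ S)] :
    Module.finrank ℂ (wordSpan n S) = ((words n).filter fun w => deg₂ w ∈ S).card := by
  rw [wordSpan, Submodule.comap_equiv_eq_map_symm, LinearEquiv.finrank_map_eq, ← coe_filter_words,
    (Finsupp.supportedEquivFinsupp _).finrank_eq]
  simp

instance (n : ℕ) (S : Set ℕ) : FiniteDimensional ℂ (wordSpan n S) := by
  classical
  rw [wordSpan, Submodule.comap_equiv_eq_map_symm, ← coe_filter_words]
  have := (Finsupp.supportedEquivFinsupp (M := ℂ) (R := ℂ)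
    (↑((words n).filter fun w => deg₂ w ∈ S) : Set (FreeMagma (Fin 2)))).symm.finiteDimensional
  exact Module.Finite.map _ _

theorem raise_mem_wordSpan {n : ℕ} {S : Set ℕ} {f : FreeAlg 2} (hf : f ∈ wordSpan n S) :
    raise f ∈ wordSpan n {j | j + 1 ∈ S} := by
  rw [mem_wordSpan] at hf ⊢
  intro v hv
  obtain ⟨w, h1, h2, h3⟩ := exists_coeff_of_coeff_raise hv
  exact ⟨h2.trans (hf w h1).1, by simpa [h3] using (hf w h1).2⟩

theorem lower_mem_wordSpan {n : ℕ} {S : Set ℕ} {f : FreeAlg 2}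
    (hf : f ∈ wordSpan n {j | j + 1 ∈ S}) : lower f ∈ wordSpan n S := by
  rw [mem_wordSpan] at hf ⊢
  intro v hv
  obtain ⟨w, h1, h2, h3⟩ := exists_coeff_of_coeff_lower hv
  exact ⟨h2.trans (hf w h1).1, by simpa [h3] using (hf w h1).2⟩

/-- The raising operator between spans of monomials. -/
def raiseRestrict (n : ℕ) (S : Set ℕ) : wordSpan n S →ₗ[ℂ] wordSpan n {j | j + 1 ∈ S} :=
  raise.restrict fun _ => raise_mem_wordSpan

/-- The lowering operator between spans of monomials. -/
def lowerRestrict (n : ℕ) (S : Set ℕ) : wordSpan n {j | j + 1 ∈ S} →ₗ[ℂ] wordSpan n S :=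
  lower.restrict fun _ => lower_mem_wordSpan

/-- The raising operator is surjective onto spans of monomials of positive weight: there
`raise ∘ lower` is an injective endomorphism of a finite-dimensional space. -/
theorem raiseRestrict_surjective {n : ℕ} {S : Set ℕ} (hS : ∀ j, j + 1 ∈ S → 2 * j < n) :
    Function.Surjective (raiseRestrict n S) := by
  have hinj : Function.Injective (raiseRestrict n S ∘ₗ lowerRestrict n S) := by
    rw [injective_iff_map_eq_zero]
    intro f hf
    have h0 : raise (lower f.1) = 0 := congr(($hf).1)
    refine Subtype.ext (eq_zero_of_raise_lower_eq_zero h0 fun w hw => ?_)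
    obtain ⟨h1, h2⟩ := mem_wordSpan.1 f.2 w hw
    rw [h1]
    exact hS _ h2
  exact Function.Surjective.of_comp (LinearMap.injective_iff_surjective.1 hinj)

/-- The dimension of the space of highest weight vectors. -/
theorem finrank_ker_raise_inf_wordSpan {n : ℕ} {S : Set ℕ} [DecidablePred (· ∈ S)]
    (hS : ∀ j, j + 1 ∈ S → 2 * j < n) :
    Module.finrank ℂ ↥(LinearMap.ker raise ⊓ wordSpan n S) +
      ((words n).filter fun w => deg₂ w + 1 ∈ S).card =
      ((words n).filter fun w => deg₂ w ∈ S).card := by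
  have h1 := LinearMap.finrank_range_add_finrank_ker (raiseRestrict n S)
  rw [LinearMap.range_eq_top.2 (raiseRestrict_surjective hS), finrank_top, finrank_wordSpan,
    finrank_wordSpan] at h1
  have h2 : LinearMap.ker raise ⊓ wordSpan n S =
      (LinearMap.ker (raiseRestrict n S)).map (wordSpan n S).subtype := by
    ext f
    simp only [Submodule.mem_inf, LinearMap.mem_ker, Submodule.mem_map, Submodule.subtype_apply,
      Subtype.exists, exists_and_right, exists_eq_right]
    constructor
    · rintro ⟨h, h'⟩
      exact ⟨h', Subtype.ext h⟩
    · rintro ⟨h', h⟩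
      exact ⟨congr(($h).1), h'⟩
  rw [h2, Submodule.finrank_map_subtype_eq, add_comm]
  exact h1

/-- The weights of a highest weight vector are nonnegative. -/
theorem ker_raise_inf_wordSpan_univ (n : ℕ) :
    LinearMap.ker raise ⊓ wordSpan n Set.univ =
      LinearMap.ker raise ⊓ wordSpan n (Set.Iic (n / 2)) := by
  refine le_antisymm ?_ (inf_le_inf_left _ fun f hf => mem_wordSpan.2 fun w hw =>
    ⟨(mem_wordSpan.1 hf w hw).1, trivial⟩)
  intro f hf
  rw [Submodule.mem_inf, LinearMap.mem_ker] at hf ⊢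
  obtain ⟨hf, hfn⟩ := hf
  refine ⟨hf, ?_⟩
  -- `p` is the part of `f` of negative weight
  classical
  let p : FreeAlg 2 := ofCoeff (f.coeff.filter fun w => n / 2 < deg₂ w)
  have hp (w) : p.coeff w = if n / 2 < deg₂ w then f.coeff w else 0 := Finsupp.filter_apply ..
  -- `raise p` and `raise (f - p)` have no monomial in common, and their sum is zero
  have hp0 : raise p = 0 := by
    ext v
    by_contra hv
    have hv' : (raise (f - p)).coeff v ≠ 0 := by
      rwa [map_sub, hf, zero_sub, coeff_neg, Finsupp.neg_apply, neg_ne_zero]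
    obtain ⟨w, h1, -, h2⟩ := exists_coeff_of_coeff_raise hv
    obtain ⟨w', h1', -, h2'⟩ := exists_coeff_of_coeff_raise hv'
    rw [hp] at h1
    rw [coeff_sub, Finsupp.sub_apply, hp] at h1'
    have h3 : n / 2 < deg₂ w := by by_contra h; simp [h] at h1
    have h4 : ¬ n / 2 < deg₂ w' := by intro h; simp [h] at h1'
    lia
  have hpz : p = 0 := by
    refine eq_zero_of_raise_eq_zero hp0 fun w hw => ?_
    rw [hp] at hw
    have h3 : n / 2 < deg₂ w := by by_contra h; simp [h] at hw
    have h4 := (mem_wordSpan.1 hfn w (by simpa [h3] using hw)).1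
    lia
  refine mem_wordSpan.2 fun w hw => ⟨(mem_wordSpan.1 hfn w hw).1, ?_⟩
  by_contra h
  rw [Set.mem_Iic, not_le] at h
  have := hp w
  rw [hpz, if_pos h] at this
  exact hw this.symm

/-! ### The Hilbert functions -/

open Matrix.GeneralLinearGroup in
theorem act_upperRightHom_eq_self_iff (f : FreeAlg 2) :
    (∀ α : ℂ, act (upperRightHom α) f = f) ↔ raise f = 0 := by
  refine act_eq_self_iff (g := fun α => upperRightHom α) ?_ (fun α => ?_) f
  · ext i j; fin_cases i <;> fin_cases j <;> simp
  · ext i j; fin_cases i <;> fin_cases j <;> simp [upperRightHom]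

/-- The lower unitriangular matrix `(1, 0; α, 1)`. -/
def lowerLeft (α : ℂ) : GL (Fin 2) ℂ :=
  ⟨!![1, 0; α, 1], !![1, 0; -α, 1], by simp [Matrix.one_fin_two], by simp [Matrix.one_fin_two]⟩

theorem act_lowerLeft_eq_self_iff (f : FreeAlg 2) :
    (∀ α : ℂ, act (lowerLeft α) f = f) ↔ lower f = 0 := by
  refine act_eq_self_iff (g := lowerLeft) ?_ (fun α => ?_) f
  · ext i j; fin_cases i <;> fin_cases j <;> simp
  · ext i j; fin_cases i <;> fin_cases j <;> simp [lowerLeft]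

theorem mem_invariants_UT2 (f : FreeAlg 2) : f ∈ invariants UT2 ↔ raise f = 0 := by
  rw [← act_upperRightHom_eq_self_iff]
  constructor
  · intro h α
    exact h _ ⟨Multiplicative.ofAdd α, rfl⟩
  · rintro h _ ⟨α, rfl⟩
    exact h α.toAdd

open Matrix.GeneralLinearGroup in
/-- `SL_2` is generated by the unitriangular matrices. -/
theorem act_eq_self_of_det_eq_one {f : FreeAlg 2} (hU : ∀ α : ℂ, act (upperRightHom α) f = f)
    (hL : ∀ α, act (lowerLeft α) f = f) {g : GL (Fin 2) ℂ} (hg : g.1.det = 1) : act g f = f := by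
  -- if the lower left entry is nonzero, the matrix is upper times lower times upper unitriangular
  have main : ∀ g : GL (Fin 2) ℂ, g.1.det = 1 → g.1 1 0 ≠ 0 → act g f = f := by
    intro g hg hc
    rw [Matrix.det_fin_two] at hg
    have : g = upperRightHom ((g.1 0 0 - 1) / g.1 1 0) * lowerLeft (g.1 1 0) *
        upperRightHom ((g.1 1 1 - 1) / g.1 1 0) := by
      ext i j
      fin_cases i <;> fin_cases j <;> simp [upperRightHom, lowerLeft, Matrix.mul_apply] <;>
        field_simp <;> first | ring1 | linear_combination hg | linear_combination -hg
    rw [this, act_mul, act_mul, hU, hL, hU]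
  -- otherwise a row operation makes the lower left entry nonzero
  by_cases hc : g.1 1 0 = 0
  · have h1 : act (lowerLeft 1 * g) f = f := by
      refine main _ ?_ ?_
      · rw [Units.val_mul, Matrix.det_mul, hg]
        simp [lowerLeft]
      · have h0 : g.1 0 0 ≠ 0 := by
          intro h
          simp [Matrix.det_fin_two, h, hc] at hg
        simpa [lowerLeft, Matrix.mul_apply, hc] using h0
    have h2 : act (lowerLeft (-1)) (act (lowerLeft 1) (act g f)) = act g f := by
      rw [← act_mul, show lowerLeft (-1) * lowerLeft 1 = 1 from
        Units.ext (by simp [lowerLeft, Matrix.one_fin_two]), act_one]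
    rw [← h2, ← act_mul (lowerLeft 1), h1, hL]
  · exact main g hg hc

theorem mem_invariants_SL2 (f : FreeAlg 2) :
    f ∈ invariants SL2 ↔ raise f = 0 ∧ lower f = 0 := by
  rw [← act_upperRightHom_eq_self_iff, ← act_lowerLeft_eq_self_iff]
  constructor
  · intro h
    exact ⟨fun α => h _ (Units.ext (by simp [Matrix.GeneralLinearGroup.upperRightHom])),
      fun α => h _ (Units.ext (by simp [lowerLeft]))⟩
  · rintro ⟨hU, hL⟩ g hg
    exact act_eq_self_of_det_eq_one hU hL congr(($hg).1)

theorem invariants_UT2_inf_component (n : ℕ) :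
    (invariants UT2).toSubmodule ⊓ component 2 n =
      LinearMap.ker raise ⊓ wordSpan n (Set.Iic (n / 2)) := by
  rw [← ker_raise_inf_wordSpan_univ, component_eq_wordSpan]
  congr 1
  ext f
  exact mem_invariants_UT2 f

/-- The `SL_2`-invariants are the highest weight vectors of weight zero. -/
theorem invariants_SL2_inf_component (n : ℕ) :
    (invariants SL2).toSubmodule ⊓ component 2 n =
      LinearMap.ker raise ⊓ wordSpan n {j | 2 * j = n} := by
  rw [component_eq_wordSpan]
  ext f
  simp only [Submodule.mem_inf, NonUnitalSubalgebra.mem_toSubmodule, mem_invariants_SL2,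
    LinearMap.mem_ker, mem_wordSpan, Set.mem_univ, and_true, Set.mem_ofPred_eq]
  constructor
  · rintro ⟨⟨hr, hl⟩, hn⟩
    refine ⟨hr, fun w hw => ⟨hn w hw, ?_⟩⟩
    have h := coeff_weight f w
    rw [← raise_lower_sub, hr, hl, map_zero, map_zero, sub_zero, coeff_zero, Finsupp.zero_apply,
      eq_comm, mul_eq_zero, or_iff_left hw, hn w hw, sub_eq_zero] at h
    exact_mod_cast h.symm
  · rintro ⟨hr, hn⟩
    exact ⟨⟨hr, lower_eq_zero_of_raise_eq_zero hr fun w hw => by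
      rw [(hn w hw).1, (hn w hw).2]⟩, fun w hw => (hn w hw).1⟩

theorem coeff_hilbertSeries_zero (G : Subgroup (GL (Fin 2) ℂ)) :
    PowerSeries.coeff 0 (hilbertSeries (invariants G)) = 0 := by
  have h : component 2 0 = ⊥ := by
    rw [component, Submodule.span_eq_bot]
    rintro _ ⟨w, hw, rfl⟩
    exact absurd hw w.length_pos.ne'
  rw [hilbertSeries, PowerSeries.coeff_mk, h, inf_bot_eq, finrank_bot]

/-- The dimension is the number of monomials of degree at most `⌊(n + 1) / 2⌋` in `x_2` minus the
number of those of smaller degree. -/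
theorem coeff_hilbertSeries_UT2 (n : ℕ) :
    PowerSeries.coeff (n + 1) (hilbertSeries (invariants UT2)) =
      catalan n * (n + 1).choose ((n + 1) / 2) := by
  rw [hilbertSeries, PowerSeries.coeff_mk, invariants_UT2_inf_component]
  have h := finrank_ker_raise_inf_wordSpan (n := n + 1) (S := Set.Iic ((n + 1) / 2))
    (fun j hj => by rw [Set.mem_Iic] at hj; lia)
  have h2 : (words (n + 1)).filter (fun w => deg₂ w ∈ Set.Iic ((n + 1) / 2)) =
      ((words (n + 1)).filter fun w => deg₂ w = (n + 1) / 2) ∪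
        (words (n + 1)).filter fun w => deg₂ w + 1 ∈ Set.Iic ((n + 1) / 2) := by
    ext w
    simp only [Finset.mem_filter, Finset.mem_union, Set.mem_Iic, ← and_or_left]
    refine and_congr_right fun _ => ?_
    lia
  rw [h2, Finset.card_union_of_disjoint, card_words_filter_deg₂_eq] at h
  · lia
  · refine Finset.disjoint_filter.2 fun w _ h1 h2 => ?_
    rw [Set.mem_Iic] at h2
    lia

theorem centralBinom_eq_catalan_add (m : ℕ) :
    m.centralBinom = catalan m + (2 * m).choose (m + 1) := by
  have h1 := Nat.choose_succ_right_eq (2 * m) m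
  have h2 := succ_mul_catalan_eq_centralBinom m
  rw [← Nat.centralBinom_eq_two_mul_choose, show 2 * m - m = m by lia] at h1
  have : (m + 1) * m.centralBinom = (m + 1) * (catalan m + (2 * m).choose (m + 1)) := by
    linarith
  exact Nat.eq_of_mul_eq_mul_left (by lia) this

/-- For `n + 1 = 2 m`, the dimension is the number of monomials of degree `m` in `x_2` minus the
number of those of degree `m - 1`. -/
theorem coeff_hilbertSeries_SL2 (n : ℕ) :
    PowerSeries.coeff (n + 1) (hilbertSeries (invariants SL2)) =
      catalan n * if Even (n + 1) then catalan ((n + 1) / 2) else 0 := by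
  rw [hilbertSeries, PowerSeries.coeff_mk, invariants_SL2_inf_component]
  have h := finrank_ker_raise_inf_wordSpan (n := n + 1) (S := {j | 2 * j = n + 1})
    (fun j hj => by rw [Set.mem_ofPred_eq] at hj; lia)
  split_ifs with hn
  · obtain ⟨m, hm⟩ := hn
    have h1 (w) : deg₂ w + 1 ∈ {j | 2 * j = n + 1} ↔ deg₂ w = m - 1 := by
      rw [Set.mem_ofPred_eq]; lia
    have h2 (w) : deg₂ w ∈ {j | 2 * j = n + 1} ↔ deg₂ w = m := by
      rw [Set.mem_ofPred_eq]; lia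
    simp only [h1, h2, card_words_filter_deg₂_eq] at h
    have h3 := centralBinom_eq_catalan_add m
    rw [Nat.centralBinom_eq_two_mul_choose, ← Nat.choose_symm_of_eq_add
      (show 2 * m = (m - 1) + (m + 1) by lia), show 2 * m = n + 1 by lia] at h3
    rw [h3, mul_add] at h
    rw [show (n + 1) / 2 = m by lia]
    lia
  · have h2 (w) : deg₂ w ∉ {j | 2 * j = n + 1} := by
      intro h
      exact hn ⟨deg₂ w, by rw [Set.mem_ofPred_eq] at h; lia⟩
    simp only [h2, Finset.filter_false, Finset.card_empty] at h
    lia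

end

section

open Real

/-! ### The generating function of the Catalan numbers -/

theorem centralBinom_succ_div_four_pow (n : ℕ) :
    ((n + 1).centralBinom : ℝ) / 4 ^ (n + 1) =
      (2 * n + 1) / (2 * n + 2) * (n.centralBinom / 4 ^ n) := by
  have h : ((n : ℝ) + 1) * (n + 1).centralBinom = 2 * (2 * n + 1) * n.centralBinom := by
    exact_mod_cast Nat.succ_mul_centralBinom_succ n
  rw [pow_succ]
  field_simp
  linear_combination 2 * h

/-- The sum of the `C_n / 4 ^ n` telescopes. -/
theorem sum_catalan_div (N : ℕ) :
    ∑ n ∈ Finset.range N, (catalan n : ℝ) / 4 ^ n = 2 * (1 - N.centralBinom / 4 ^ N) := by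
  induction N with
  | zero => simp
  | succ N ih =>
    have h : ((N : ℝ) + 1) * catalan N = N.centralBinom := by
      exact_mod_cast succ_mul_catalan_eq_centralBinom N
    rw [Finset.sum_range_succ, ih, centralBinom_succ_div_four_pow, ← h]
    field_simp
    ring

theorem summable_catalan_div : Summable fun n => (catalan n : ℝ) / 4 ^ n :=
  summable_of_sum_range_le (c := 2) (fun _ => by positivity) fun N => by
    rw [sum_catalan_div]
    have : (0 : ℝ) ≤ N.centralBinom / 4 ^ N := by positivity
    linarith

theorem tsum_catalan_div_le : ∑' n, (catalan n : ℝ) / 4 ^ n ≤ 2 :=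
  summable_catalan_div.tsum_le_of_sum_range_le fun N => by
    rw [sum_catalan_div]
    have : (0 : ℝ) ≤ N.centralBinom / 4 ^ N := by positivity
    linarith

theorem norm_catalan_mul_pow_le {z : ℝ} (hz : |z| ≤ 1 / 4) (n : ℕ) :
    ‖(catalan n : ℝ) * z ^ n‖ ≤ catalan n / 4 ^ n := by
  rw [norm_mul, norm_pow, Real.norm_natCast, Real.norm_eq_abs, div_eq_mul_inv, ← inv_pow]
  gcongr
  linarith

/-- The sum `S` of the Catalan series solves `S = 1 + z S ^ 2`, that is, `(1 - 2 z S) ^ 2 = 1 - 4 z`;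
the bound `|S| ≤ 2` shows that `1 - 2 z S` is the nonnegative square root. -/
theorem hasSum_catalan {z : ℝ} (hz : |z| ≤ 1 / 4) :
    HasSum (fun n => 2 * (catalan n : ℝ) * z ^ (n + 1)) (1 - √(1 - 4 * z)) := by
  have hs : Summable fun n => ‖(catalan n : ℝ) * z ^ n‖ :=
    .of_nonneg_of_le (fun _ => norm_nonneg _) (norm_catalan_mul_pow_le hz) summable_catalan_div
  set S := ∑' n, (catalan n : ℝ) * z ^ n with hS
  have hbound : |S| ≤ 2 :=
    ((norm_tsum_le_tsum_norm hs).trans (hs.tsum_le_tsum (norm_catalan_mul_pow_le hz)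
      summable_catalan_div)).trans tsum_catalan_div_le
  have hquad : S = 1 + z * S ^ 2 := by
    rw [sq, hS, tsum_mul_tsum_eq_tsum_sum_antidiagonal_of_summable_norm hs hs, ← tsum_mul_left,
      hs.of_norm.tsum_eq_zero_add]
    congr 1
    · simp
    · refine tsum_congr fun n => ?_
      rw [catalan_succ', Nat.cast_sum, Finset.sum_mul, Finset.mul_sum]
      refine Finset.sum_congr rfl fun ij hij => ?_
      rw [← Finset.HasAntidiagonal.mem_antidiagonal.1 hij]
      push_cast
      ring
  have hnonneg : 0 ≤ 1 - 2 * z * S := by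
    have : |z * S| ≤ 1 / 4 * 2 := by
      rw [abs_mul]
      gcongr
    linarith [(abs_le.1 this).2]
  have hsqrt : √(1 - 4 * z) = 1 - 2 * z * S := by
    rw [Real.sqrt_eq_iff_eq_sq (by linarith [(abs_le.1 hz).2]) hnonneg]
    linear_combination 4 * z * hquad
  rw [hsqrt, show 1 - (1 - 2 * z * S) = 2 * z * S by ring]
  convert! hs.of_norm.hasSum.mul_left (2 * z) using 2 with n
  ring

/-! ### Moments of the cosine -/

/-- The moments of `cos (2 π u)` on the unit interval. -/
def cosMoment (n : ℕ) : ℝ := ∫ u in (0 : ℝ)..1, cos (2 * π * u) ^ n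

theorem cosMoment_eq (n : ℕ) : cosMoment n = (2 * π)⁻¹ * ∫ x in (0 : ℝ)..2 * π, cos x ^ n := by
  have := intervalIntegral.integral_comp_mul_left (a := 0) (b := 1) (fun x => cos x ^ n)
    (show 2 * π ≠ 0 by positivity)
  simpa [cosMoment] using this

theorem cosMoment_add_two (n : ℕ) : cosMoment (n + 2) = (n + 1) / (n + 2) * cosMoment n := by
  rw [cosMoment_eq, cosMoment_eq, integral_cos_pow]
  simp
  ring

theorem cosMoment_even (m : ℕ) : cosMoment (2 * m) = m.centralBinom / 4 ^ m := by
  induction m with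
  | zero => simp [cosMoment]
  | succ m ih =>
    rw [mul_add, mul_one, cosMoment_add_two, ih, centralBinom_succ_div_four_pow]
    push_cast
    rfl

theorem cosMoment_odd (m : ℕ) : cosMoment (2 * m + 1) = 0 := by
  induction m with
  | zero => simp [cosMoment_eq]
  | succ m ih => rw [show 2 * (m + 1) + 1 = 2 * m + 1 + 2 by ring, cosMoment_add_two, ih, mul_zero]

theorem two_pow_mul_cosMoment_add (n : ℕ) :
    2 ^ n * (cosMoment n + cosMoment (n + 1)) = n.choose (n / 2) := by
  obtain ⟨m, rfl | rfl⟩ := n.even_or_odd'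
  · rw [cosMoment_even, cosMoment_odd, show 2 * m / 2 = m by lia,
      ← Nat.centralBinom_eq_two_mul_choose, pow_mul]
    norm_num
    field_simp
  · have h1 : (m + 1).centralBinom = 2 * (2 * m + 1).choose m := by
      rw [Nat.centralBinom_eq_two_mul_choose, show 2 * (m + 1) = 2 * m + 1 + 1 by ring,
        Nat.choose_succ_succ', Nat.choose_symm_of_eq_add (show 2 * m + 1 = (m + 1) + m by ring)]
      ring
    rw [cosMoment_odd, show 2 * m + 1 + 1 = 2 * (m + 1) by ring, cosMoment_even,
      show (2 * m + 1) / 2 = m by lia, h1, pow_succ, pow_succ, pow_mul]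
    push_cast
    norm_num
    field_simp
    ring

theorem two_pow_mul_cosMoment_sub (n : ℕ) :
    2 ^ (n + 1) * (cosMoment n - cosMoment (n + 2)) =
      if Even n then (catalan (n / 2) : ℝ) else 0 := by
  obtain ⟨m, rfl | rfl⟩ := n.even_or_odd'
  · have h : ((m : ℝ) + 1) * catalan m = m.centralBinom := by
      exact_mod_cast succ_mul_catalan_eq_centralBinom m
    rw [if_pos (by simp), cosMoment_add_two, cosMoment_even, show 2 * m / 2 = m by lia, pow_succ,
      pow_mul, ← h]
    push_cast
    norm_num
    field_simp
    ring
  · rw [if_neg (by simp), cosMoment_add_two, cosMoment_odd]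
    ring

/-! ### Integral formulas for the Hilbert series -/

/-- Integrating the Catalan generating function termwise. -/
theorem hasSum_integral_catalan {g : ℝ → ℝ} (hg : Continuous g) {t : ℝ} (ht : |t| < 1 / 8) :
    HasSum (fun n => (catalan n : ℝ) * t ^ (n + 1) *
        (2 ^ (n + 2) * ∫ u in (0 : ℝ)..1, g u * cos (2 * π * u) ^ (n + 1)))
      (∫ u in (0 : ℝ)..1, g u * (1 - √(1 - 8 * t * cos (2 * π * u)))) := by
  have hz (u : ℝ) : |2 * t * cos (2 * π * u)| ≤ 1 / 4 := by
    rw [abs_mul, abs_mul, abs_two]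
    nlinarith [abs_cos_le_one (2 * π * u), abs_nonneg t, abs_nonneg (cos (2 * π * u))]
  -- the summands are dominated by `|g u| * C_n / 4 ^ n`
  have h := intervalIntegral.hasSum_integral_of_dominated_convergence (a := 0) (b := 1)
    (μ := MeasureTheory.volume)
    (F := fun n u => g u * (2 * (catalan n : ℝ) * (2 * t * cos (2 * π * u)) ^ (n + 1)))
    (f := fun u => g u * (1 - √(1 - 4 * (2 * t * cos (2 * π * u)))))
    (fun n u => |g u| * ((catalan n : ℝ) / 4 ^ n))
    (fun n => (by fun_prop : Continuous _).aestronglyMeasurable)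
    (fun n => .of_forall fun u _ => ?_) (.of_forall fun u _ => summable_catalan_div.mul_left _)
    ?_ (.of_forall fun u _ => (hasSum_catalan (hz u)).mul_left _)
  · convert! h using 2 with n
    · rw [← intervalIntegral.integral_const_mul, ← intervalIntegral.integral_const_mul]
      congr 1 with u
      ring
    · congr 1 with u
      congr 4
      ring
  · rw [norm_mul, Real.norm_eq_abs]
    refine mul_le_mul_of_nonneg_left ?_ (abs_nonneg _)
    refine le_trans (le_of_eq_of_le (b := ‖2 * (2 * t * cos (2 * π * u))‖ * _) ?_
      (mul_le_of_le_one_left (norm_nonneg _) ?_))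
      (norm_catalan_mul_pow_le (hz u) n)
    · rw [← norm_mul]
      congr 1
      ring
    · rw [norm_mul, Real.norm_eq_abs, Real.norm_eq_abs, abs_two]
      linarith [hz u]
  · simp only [tsum_mul_left]
    exact (by fun_prop : Continuous _).intervalIntegrable _ _

theorem integral_sin_sq_mul_cos_pow (n : ℕ) :
    ∫ u in (0 : ℝ)..1, sin (2 * π * u) ^ 2 * cos (2 * π * u) ^ n =
      cosMoment n - cosMoment (n + 2) := by
  rw [cosMoment, cosMoment, ← intervalIntegral.integral_sub]
  · congr 1 with u
    rw [sin_sq]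
    ring
  all_goals exact (by fun_prop : Continuous _).intervalIntegrable _ _

theorem cos_pi_mul_sq (u : ℝ) : cos (π * u) ^ 2 = (1 + cos (2 * π * u)) / 2 := by
  rw [cos_sq, ← mul_assoc]
  ring

theorem integral_cos_sq_mul_cos_pow (n : ℕ) :
    ∫ u in (0 : ℝ)..1, cos (π * u) ^ 2 * cos (2 * π * u) ^ n =
      (cosMoment n + cosMoment (n + 1)) / 2 := by
  rw [cosMoment, cosMoment, ← intervalIntegral.integral_add, ← intervalIntegral.integral_div]
  · congr 1 with u
    rw [cos_pi_mul_sq]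
    ring
  all_goals exact (by fun_prop : Continuous _).intervalIntegrable _ _

theorem hasSum_terms_SL2 {t : ℝ} (ht : |t| < 1 / 8) :
    HasSum (terms (hilbertSeries (invariants SL2)) t)
      (∫ u in (0 : ℝ)..1, sin (2 * π * u) ^ 2 * (1 - √(1 - 8 * t * cos (2 * π * u)))) := by
  rw [← hasSum_nat_add_iff' 1]
  simp only [Finset.sum_range_one, terms, coeff_hilbertSeries_zero, Nat.cast_zero, zero_mul,
    sub_zero]
  convert! hasSum_integral_catalan (g := fun u => sin (2 * π * u) ^ 2) (by fun_prop) ht using 2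
    with n
  rw [integral_sin_sq_mul_cos_pow, show n + 2 = n + 1 + 1 by ring, two_pow_mul_cosMoment_sub,
    coeff_hilbertSeries_SL2]
  push_cast
  ring

theorem hasSum_terms_UT2 {t : ℝ} (ht : |t| < 1 / 8) :
    HasSum (terms (hilbertSeries (invariants UT2)) t)
      (∫ u in (0 : ℝ)..1, cos (π * u) ^ 2 * (1 - √(1 - 8 * t * cos (2 * π * u)))) := by
  rw [← hasSum_nat_add_iff' 1]
  simp only [Finset.sum_range_one, terms, coeff_hilbertSeries_zero, Nat.cast_zero, zero_mul,
    sub_zero]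
  convert! hasSum_integral_catalan (g := fun u => cos (π * u) ^ 2) (by fun_prop) ht using 2
    with n
  rw [integral_cos_sq_mul_cos_pow, coeff_hilbertSeries_UT2]
  push_cast
  rw [← two_pow_mul_cosMoment_add]
  ring

end

section

open Real MeasureTheory

/-! ### Reduction to elliptic integrals -/

/-- The integral over a period of the cosine is twice the integral over half a period. -/
theorem integral_comp_cos {h : ℝ → ℝ} (hh : Continuous h) :
    ∫ u in (0 : ℝ)..1, h (cos (2 * π * u)) = π⁻¹ * ∫ x in (0 : ℝ)..π, h (cos x) := by
  have h1 := intervalIntegral.integral_comp_mul_left (a := 0) (b := 1) (fun x => h (cos x))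
    (show 2 * π ≠ 0 by positivity)
  have h2 := intervalIntegral.integral_comp_sub_left (a := 0) (b := π) (fun x => h (cos x)) (2 * π)
  have hi (a b : ℝ) : IntervalIntegrable (fun x => h (cos x)) volume a b :=
    (by fun_prop : Continuous _).intervalIntegrable _ _
  have h3 := intervalIntegral.integral_add_adjacent_intervals (hi 0 π) (hi π (2 * π))
  simp only [cos_two_pi_sub, sub_zero, show 2 * π - π = π by ring] at h2
  rw [← h2] at h3
  simp only [mul_zero, mul_one] at h1
  rw [h1, ← h3, smul_eq_mul]
  field_simp
  ring

theorem image_cos_Ioo : cos '' Set.Ioo 0 π = Set.Ioo (-1) 1 := by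
  ext x
  constructor
  · rintro ⟨θ, hθ, rfl⟩
    have h0 : (0 : ℝ) ∈ Set.Icc 0 π := ⟨le_rfl, pi_pos.le⟩
    have hpi : π ∈ Set.Icc 0 π := ⟨pi_pos.le, le_rfl⟩
    have hm := Set.Ioo_subset_Icc_self hθ
    constructor
    · simpa using strictAntiOn_cos hm hpi hθ.2
    · simpa using strictAntiOn_cos h0 hm hθ.1
  · intro hx
    exact ⟨arccos x, ⟨arccos_pos.2 hx.2, arccos_lt_pi.2 hx.1⟩, cos_arccos hx.1.le hx.2.le⟩

/-- The substitution `x = cos θ`, for integrands which may be singular at the end points. -/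
theorem integral_eq_of_comp_cos {k φ : ℝ → ℝ} (hφ : Continuous φ)
    (h : ∀ θ ∈ Set.Ioo 0 π, sin θ * k (cos θ) = φ θ) :
    IntervalIntegrable k volume (-1) 1 ∧ ∫ x in (-1 : ℝ)..1, k x = ∫ θ in (0 : ℝ)..π, φ θ := by
  have hd : ∀ θ ∈ Set.Ioo 0 π, HasDerivWithinAt cos (-sin θ) (Set.Ioo 0 π) θ :=
    fun θ _ => (hasDerivAt_cos θ).hasDerivWithinAt
  have hinj : Set.InjOn cos (Set.Ioo 0 π) := injOn_cos.mono Set.Ioo_subset_Icc_self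
  have hcongr : ∀ θ ∈ Set.Ioo 0 π, |(-sin θ)| • k (cos θ) = φ θ := fun θ hθ => by
    rw [abs_neg, abs_of_pos (sin_pos_of_mem_Ioo hθ), smul_eq_mul, h θ hθ]
  constructor
  · rw [intervalIntegrable_iff_integrableOn_Ioo_of_le (by norm_num), ← image_cos_Ioo,
      integrableOn_image_iff_integrableOn_abs_deriv_smul measurableSet_Ioo hd hinj,
      integrableOn_congr_fun hcongr measurableSet_Ioo]
    exact (hφ.integrableOn_Icc (a := 0) (b := π)).mono_set Set.Ioo_subset_Icc_self
  · rw [intervalIntegral.integral_of_le (by norm_num), intervalIntegral.integral_of_le pi_pos.le,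
      integral_Ioc_eq_integral_Ioo, integral_Ioc_eq_integral_Ioo, ← image_cos_Ioo,
      integral_image_eq_integral_abs_deriv_smul measurableSet_Ioo hd hinj]
    exact setIntegral_congr_fun measurableSet_Ioo hcongr

open Polynomial in
/-- The cubic polynomial `(1 - x ^ 2) (1 - 8 t x)` in `x`, with coefficients polynomial in `t`. -/
def cubic : ℝ[X][X] := (1 - X ^ 2) * (1 - C (C 8 * X) * X)

open Polynomial in
theorem map_cubic (t : ℝ) :
    cubic.map (evalRingHom t) = (1 - X ^ 2) * (1 - C (8 * t) * X) := by
  simp [cubic]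

open Polynomial in
theorem eval_map_cubic (t x : ℝ) :
    (cubic.map (evalRingHom t)).eval x = (1 - x ^ 2) * (1 - 8 * t * x) := by
  simp [map_cubic]

open Polynomial in
theorem natDegree_map_cubic {t : ℝ} (ht : t ≠ 0) :
    (cubic.map (evalRingHom t)).natDegree = 3 := by
  rw [map_cubic, show ((1 - X ^ 2) * (1 - C (8 * t) * X) : ℝ[X]) =
    C (8 * t) * X ^ 3 + (- X ^ 2 - C (8 * t) * X + 1) by ring]
  compute_degree!

open Polynomial in
/-- The roots `1`, `-1` and `1 / (8 t)` of the cubic are distinct. -/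
theorem separable_map_cubic {t : ℝ} (ht : t ≠ 0) (ht' : |t| < 1 / 8) :
    (cubic.map (evalRingHom t)).Separable := by
  have h0 : 8 * t ≠ 0 := by positivity
  have h1 : (8 * t) ^ 2 - 1 ≠ 0 := by
    have : |8 * t| < 1 := by rw [abs_mul]; norm_num; linarith
    have := (sq_lt_one_iff_abs_lt_one _).2 this
    linarith
  rw [map_cubic]
  generalize 8 * t = a at h0 h1
  refine Separable.mul ?_ ?_ ?_
  · rw [separable_def']
    refine ⟨1, -C (1 / 2) * X, ?_⟩
    have : (C (1 / 2) * C 2 : ℝ[X]) = 1 := by rw [← C_mul]; norm_num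
    simp only [derivative_sub, derivative_one, derivative_X_pow, Nat.cast_ofNat, Nat.add_one_sub_one,
      pow_one]
    linear_combination X ^ 2 * this
  · rw [separable_def']
    refine ⟨0, C (-a⁻¹), ?_⟩
    simp only [derivative_sub, derivative_one, derivative_C_mul, derivative_X]
    have : (C a⁻¹ * C a : ℝ[X]) = 1 := by rw [← C_mul, inv_mul_cancel₀ h0, C_1]
    rw [C_neg]
    linear_combination this
  · refine ⟨C (a ^ 2 * (a ^ 2 - 1)⁻¹), -C (a ^ 2 - 1)⁻¹ * (1 + C a * X), ?_⟩
    have : (C (a ^ 2 - 1)⁻¹ * (C a ^ 2 - 1) : ℝ[X]) = 1 := by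
      rw [← C_pow, ← C_1, ← C_sub, ← C_mul, inv_mul_cancel₀ h1]
    rw [C_mul, C_pow]
    linear_combination this

theorem one_sub_pos {t x : ℝ} (ht : |t| < 1 / 8) (hx : |x| ≤ 1) : 0 < 1 - 8 * t * x := by
  have h : |8 * t * x| < 1 := by
    rw [abs_mul, abs_mul, abs_of_pos (by norm_num : (0 : ℝ) < 8)]
    nlinarith [abs_nonneg t, abs_nonneg x]
  linarith [(abs_lt.1 h).2]

open Polynomial in
theorem eval_map_cubic_nonneg {t x : ℝ} (ht : |t| < 1 / 8) (hx : x ∈ Set.Icc (-1) 1) :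
    0 ≤ (cubic.map (evalRingHom t)).eval x := by
  rw [eval_map_cubic]
  have := one_sub_pos ht (abs_le.2 hx)
  have : x ^ 2 ≤ 1 := (sq_le_one_iff_abs_le_one x).2 (abs_le.2 hx)
  exact mul_nonneg (by linarith) (by linarith)

open Polynomial in
theorem sqrt_eval_map_cubic_cos (t : ℝ) {θ : ℝ} (hθ : θ ∈ Set.Ioo 0 π) :
    √((cubic.map (evalRingHom t)).eval (cos θ)) = sin θ * √(1 - 8 * t * cos θ) := by
  rw [eval_map_cubic, ← sin_sq, sqrt_mul (sq_nonneg _), sqrt_sq (sin_pos_of_mem_Ioo hθ).le]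

open Polynomial in
/-- For `P(t, x) = (1 - x ^ 2) (1 - 8 t x)` on `[-1, 1]`, the conditions on an elliptic integral
reduce to those on the rational function. -/
theorem isEllipticIntegralOn_of_cubic {F : ℝ → ℝ} (N D : MvPolynomial (Fin 3) ℝ)
    (hD : ∀ t x y : ℝ, x ∈ Set.Ioo (-1) 1 → MvPolynomial.eval ![t, x, y] D ≠ 0)
    (hR : ∀ t : ℝ, ratEval N D t 0 1 ≠ ratEval N D t 0 (-1))
    (φ : ℝ → ℝ → ℝ) (hφ : ∀ t, Continuous (φ t))
    (hk : ∀ t, ∀ θ ∈ Set.Ioo 0 π,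
      sin θ * ratEval N D t (cos θ) (sin θ * √(1 - 8 * t * cos θ)) = φ t θ)
    (hF : ∀ t : ℝ, |t| < 1 / 8 → F t = ∫ θ in (0 : ℝ)..π, φ t θ) :
    IsEllipticIntegralOn {t : ℝ | t ≠ 0 ∧ |t| < 1 / 8} F := by
  refine ⟨-1, 1, cubic, N, D, by norm_num, ?_⟩
  rintro t ⟨ht0, ht⟩
  have hint := integral_eq_of_comp_cos (hφ t)
    (k := fun x => ratEval N D t x √((cubic.map (evalRingHom t)).eval x)) fun θ hθ => by
      rw [sqrt_eval_map_cubic_cos t hθ, hk t θ hθ]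
  refine ⟨_, rfl, Or.inl (natDegree_map_cubic ht0), separable_map_cubic ht0 ht,
    fun x hx => eval_map_cubic_nonneg ht hx, fun x hx => ⟨hD _ _ _ hx, hD _ _ _ hx⟩,
    ⟨0, by norm_num, ?_⟩, hint.1, ?_⟩
  · simp only [eval_map_cubic]
    simpa using hR t
  · rw [hint.2, hF t ht]

theorem integral_SL2_eq (t : ℝ) :
    ∫ u in (0 : ℝ)..1, sin (2 * π * u) ^ 2 * (1 - √(1 - 8 * t * cos (2 * π * u))) =
      ∫ θ in (0 : ℝ)..π, (sin θ / 4 - π⁻¹ * (sin θ ^ 2 * √(1 - 8 * t * cos θ))) := by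
  have h := integral_comp_cos (h := fun x => (1 - x ^ 2) * (1 - √(1 - 8 * t * x))) (by fun_prop)
  simp only [← sin_sq] at h
  have hs : ∫ θ in (0 : ℝ)..π, sin θ ^ 2 = π / 2 := by simp
  rw [h]
  simp only [mul_sub, mul_one]
  rw [intervalIntegral.integral_sub, intervalIntegral.integral_sub,
    intervalIntegral.integral_const_mul, intervalIntegral.integral_div, integral_sin, hs]
  · simp
    field_simp
    ring
  all_goals exact (by fun_prop : Continuous _).intervalIntegrable _ _

theorem integral_UT2_eq (t : ℝ) :
    ∫ u in (0 : ℝ)..1, cos (π * u) ^ 2 * (1 - √(1 - 8 * t * cos (2 * π * u))) =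
      ∫ θ in (0 : ℝ)..π, (sin θ / 4 - (2 * π)⁻¹ * ((1 + cos θ) * √(1 - 8 * t * cos θ))) := by
  have h := integral_comp_cos (h := fun x => (1 + x) / 2 * (1 - √(1 - 8 * t * x))) (by fun_prop)
  have hs : ∫ θ in (0 : ℝ)..π, (1 + cos θ) / 2 = π / 2 := by
    rw [intervalIntegral.integral_div, intervalIntegral.integral_add]
    · simp
    all_goals exact (by fun_prop : Continuous _).intervalIntegrable _ _
  simp only [← cos_pi_mul_sq] at h
  rw [h]
  simp only [mul_sub, mul_one]
  rw [intervalIntegral.integral_sub, intervalIntegral.integral_sub,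
    hs, intervalIntegral.integral_const_mul, intervalIntegral.integral_div, integral_sin]
  · simp only [div_mul_eq_mul_div]
    rw [intervalIntegral.integral_div]
    generalize ∫ θ in (0 : ℝ)..π, (1 + cos θ) * √(1 - 8 * t * cos θ) = J
    simp
    field_simp
    ring
  all_goals exact (by fun_prop : Continuous _).intervalIntegrable _ _

open MvPolynomial in
theorem isEllipticIntegralOn_SL2 : IsEllipticIntegralOn {t : ℝ | t ≠ 0 ∧ |t| < 1 / 8}
    fun t => ∑' n, terms (hilbertSeries (invariants SL2)) t n := by
  refine isEllipticIntegralOn_of_cubic (C (1 / 4) - C π⁻¹ * X 2) 1 (by simp) (fun t => ?_)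
    (fun t θ => sin θ / 4 - π⁻¹ * (sin θ ^ 2 * √(1 - 8 * t * cos θ))) (by fun_prop)
    (fun t θ _ => ?_) fun t ht => ?_
  · have := inv_pos.2 pi_pos
    simp [ratEval]
    linarith
  · simp [ratEval]
    ring
  · rw [(hasSum_terms_SL2 ht).tsum_eq, integral_SL2_eq]

open MvPolynomial in
theorem isEllipticIntegralOn_UT2 : IsEllipticIntegralOn {t : ℝ | t ≠ 0 ∧ |t| < 1 / 8}
    fun t => ∑' n, terms (hilbertSeries (invariants UT2)) t n := by
  refine isEllipticIntegralOn_of_cubic (C (1 / 4) * (1 - X 1) - C (2 * π)⁻¹ * X 2) (1 - X 1)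
    (fun t x y hx => ?_) (fun t => ?_)
    (fun t θ => sin θ / 4 - (2 * π)⁻¹ * ((1 + cos θ) * √(1 - 8 * t * cos θ))) (by fun_prop)
    (fun t θ hθ => ?_) fun t ht => ?_
  · simpa using (sub_pos.2 hx.2).ne'
  · have := inv_pos.2 pi_pos
    simp [ratEval]
    linarith
  · have h : cos θ < 1 := (image_cos_Ioo ▸ Set.mem_image_of_mem cos hθ :
      cos θ ∈ Set.Ioo (-1) 1).2
    have h' : 1 - cos θ ≠ 0 := (sub_pos.2 h).ne'
    generalize √(1 - 8 * t * cos θ) = y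
    simp [ratEval]
    field_simp
    linear_combination -4 * y * sin_sq θ
  · rw [(hasSum_terms_UT2 ht).tsum_eq, integral_UT2_eq]

end

end FreeNonassocInvariants

end

theorem mainTheorem8 :
    (∀ t : ℝ, |t| < 1 / 8 →
      HasSum
        (FreeNonassocInvariants.terms
          (FreeNonassocInvariants.hilbertSeries
            (FreeNonassocInvariants.invariants FreeNonassocInvariants.SL2)) t)
        (∫ u in (0 : ℝ)..1,
          Real.sin (2 * Real.pi * u) ^ 2 * (1 - √(1 - 8 * t * Real.cos (2 * Real.pi * u))))) ∧
    (∀ t : ℝ, |t| < 1 / 8 →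
      HasSum
        (FreeNonassocInvariants.terms
          (FreeNonassocInvariants.hilbertSeries
            (FreeNonassocInvariants.invariants FreeNonassocInvariants.UT2)) t)
        (∫ u in (0 : ℝ)..1,
          Real.cos (Real.pi * u) ^ 2 * (1 - √(1 - 8 * t * Real.cos (2 * Real.pi * u))))) ∧
    FreeNonassocInvariants.IsEllipticIntegralOn {t : ℝ | t ≠ 0 ∧ |t| < 1 / 8}
      (fun t => ∑' n, FreeNonassocInvariants.terms
        (FreeNonassocInvariants.hilbertSeries
          (FreeNonassocInvariants.invariants FreeNonassocInvariants.SL2)) t n) ∧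
    FreeNonassocInvariants.IsEllipticIntegralOn {t : ℝ | t ≠ 0 ∧ |t| < 1 / 8}
      (fun t => ∑' n, FreeNonassocInvariants.terms
        (FreeNonassocInvariants.hilbertSeries
          (FreeNonassocInvariants.invariants FreeNonassocInvariants.UT2)) t n) := by
  exact ⟨fun _ ht => FreeNonassocInvariants.hasSum_terms_SL2 ht,
    fun _ ht => FreeNonassocInvariants.hasSum_terms_UT2 ht,
    FreeNonassocInvariants.isEllipticIntegralOn_SL2,
    FreeNonassocInvariants.isEllipticIntegralOn_UT2⟩
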